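/- Let $G$ be an amenable group, i.e. a group that has a left F\o lner net: a net $(F_j)_{j\in J}$ of nonempty finite subsets of $G$ such that $\lim_{j} |gF_j\setminus F_j|/|F_j| = 0$ for every $g\in G$. Let $X$ be a compact Hausdorff space, with its unique compatible uniform structure, equipped with an action of $G$ such that $x\mapsto gx$ is continuous for every $g\in G$. Suppose that the action of $G$ on $X$ has the weak specification property: for every entourage $U$ of $X$ there is a finite subset $\Lambda\subset G$ such that, for every finite family $(\Omega_i)_{i\in I}$ of finite subsets of $G$ with $\Omega_j\cap\Lambda\Omega_k=\varnothing$ for all distinct $j,k\in I$ and every family $(x_i)_{i\in I}$ of points of $X$, there is a point $x\in X$ with $(gx,gx_i)\in U$ for all $i\in I$ and $g\in\Omega_i$. Let $Y\subsetneq X$ be a proper closed $G$-invariant subset of $X$ such that the action of $G$ on $Y$ is expansive: there is an entourage $U_0$ of $Y$ such that for all distinct $x,y\in Y$ there is $g\in G$ with $(gx,gy)\notin U_0$. Then $$h_{\mathrm{top}}(Y,G) < h_{\mathrm{top}}(X,G).$$ Here, for a topological space $Z$ with a continuous action of $G$, the topological entropy is $$h_{\mathrm{top}}(Z,G) = \sup_\alpha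 \lim_{j} \frac{\log N\bigl(\bigvee_{g\in F_j} g^{-1}\alpha\bigr)}{|F_j|},$$ where $\alpha$ runs over all finite open covers of $Z$, $(F_j)$ is any left F\o lner net for $G$ (the limit exists and does not depend on the net), $\bigvee$ denotes the join of covers (the cover by intersections of one member from each), and $N(\beta)$ is the minimal cardinality of a subcover of $\beta$. The convention $\log 0=-\infty$ is used, so that $h_{\mathrm{top}}(\varnothing,G)=-\infty$. -/

import Mathlib

open Filter Set Topology Uniformity
open scoped Pointwise

universe u v

namespace AmenableEntropy

section Amenable

open Classical in
/-- The ratio `|g F \ F| / |F|` for an element `g` and a finite subset `F` of a group `G`. -/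
noncomputable def folnerRatio {G : Type u} [Group G] (g : G) (F : Finset G) : ℝ :=
  (((g • F) \ F).card : ℝ) / (F.card : ℝ)

/-- A left Følner net for `G`: a net of nonempty finite subsets of `G`, indexed by a directed
set `J`, such that `|g F_j \ F_j| / |F_j|` tends to `0` for every `g`. -/
structure IsFolnerNet {G : Type u} [Group G] {J : Type v} [Preorder J] (F : J → Finset G) :
    Prop where
  nonempty : ∀ j, (F j).Nonempty
  tendsto : ∀ g : G, Tendsto (fun j => folnerRatio g (F j)) atTop (𝓝 0)

/-- A group is amenable if it has a left Følner net. -/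
def IsAmenable (G : Type u) [Group G] : Prop :=
  ∃ (J : Type u) (_ : Preorder J) (_ : IsDirected J (· ≤ ·)) (_ : Nonempty J)
    (F : J → Finset G), IsFolnerNet F

/-- The Følner filter on the finite subsets of `G`: a net of nonempty finite subsets tends to it
exactly when it is a left Følner net, see `isFolnerNet_iff`. -/
noncomputable def folnerFilter (G : Type u) [Group G] : Filter (Finset G) :=
  𝓟 {F | F.Nonempty} ⊓ ⨅ g : G, comap (folnerRatio g) (𝓝 0)

theorem isFolnerNet_iff {G : Type u} [Group G] {J : Type v} [Preorder J] {F : J → Finset G}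
    (hF : ∀ j, (F j).Nonempty) : IsFolnerNet F ↔ Tendsto F atTop (folnerFilter G) := by
  simp only [folnerFilter, tendsto_inf, tendsto_iInf, tendsto_comap_iff, tendsto_principal]
  exact ⟨fun h => ⟨Eventually.of_forall hF, h.tendsto⟩, fun h => ⟨hF, h.2⟩⟩

end Amenable

section Entropy

/-- A finite open cover of `X`. -/
structure IsFiniteOpenCover {X : Type v} [TopologicalSpace X] (α : Set (Set X)) : Prop where
  finite : α.Finite
  isOpen : ∀ A ∈ α, IsOpen A
  cover : ⋃₀ α = univ

/-- `N(α)`: the minimal cardinality of a subcover of `α`. -/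
noncomputable def minCard {X : Type v} (α : Set (Set X)) : ℕ∞ :=
  ⨅ β ∈ {β : Set (Set X) | β ⊆ α ∧ ⋃₀ β = univ}, β.encard

/-- The join of the covers `g⁻¹ α` over `g ∈ F`: its members are the intersections
`⋂ g ∈ F, g⁻¹ A_g` with all `A_g` in `α`. -/
def dynJoin {G : Type u} [Group G] {X : Type v} [MulAction G X] (α : Set (Set X))
    (F : Finset G) : Set (Set X) :=
  {B | ∃ A : G → Set X, (∀ g ∈ F, A g ∈ α) ∧ B = ⋂ g ∈ F, g⁻¹ • A g}

/-- `log N(α^(F)) / |F|`, with `log 0 = -∞` (this happens only for empty `X`). -/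
noncomputable def logCardRatio {G : Type u} [Group G] {X : Type v} [MulAction G X]
    (α : Set (Set X)) (F : Finset G) : EReal :=
  ENNReal.log ((minCard (dynJoin α F) : ℕ∞) : ENNReal) / (F.card : EReal)

/-- The entropy of the action relative to a finite open cover `α`: the limit of
`log N(α^(F)) / |F|` along left Følner nets. It is written as an upper limit along the filter
`folnerFilter G`, and is the common limit over all Følner nets,
see `coverEntropy_eq_of_forall_net`. -/
noncomputable def coverEntropy (G : Type u) [Group G] {X : Type v} [MulAction G X]
    (α : Set (Set X)) : EReal :=
  limsup (fun F : Finset G => logCardRatio α F) (folnerFilter G)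

/-- The topological entropy of the action of `G` on `X`: the supremum over all finite open
covers of the entropy relative to the cover. -/
noncomputable def topEntropy (G : Type u) [Group G] (X : Type v) [TopologicalSpace X]
    [MulAction G X] : EReal :=
  ⨆ α ∈ {α : Set (Set X) | IsFiniteOpenCover α}, coverEntropy G α

/-- If `log N(α^(F_j)) / |F_j|` tends to one and the same `c` along every left Følner net, then
`coverEntropy G α = c`. -/
theorem coverEntropy_eq_of_forall_net {G : Type u} [Group G] (hG : IsAmenable G) {X : Type v}
    [MulAction G X] (α : Set (Set X)) (c : EReal)
    (h : ∀ (J : Type u) [Preorder J] [IsDirected J (· ≤ ·)] [Nonempty J] (F : J → Finset G),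
      IsFolnerNet F → Tendsto (fun j => logCardRatio α (F j)) atTop (𝓝 c)) :
    coverEntropy G α = c := by
  have hne : (folnerFilter G).NeBot := by
    obtain ⟨J, _, _, _, F, hF⟩ := hG
    exact ((isFolnerNet_iff hF.nonempty).1 hF).neBot
  refine Tendsto.limsup_eq ?_
  by_contra hnot
  simp only [Tendsto, Filter.le_def, not_forall] at hnot
  obtain ⟨s, hs, hsn⟩ := hnot
  have hfin : ∀ t ∈ folnerFilter G, ∃ F ∈ t, F.Nonempty ∧ logCardRatio α F ∉ s := by
    intro t ht
    by_contra hcon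
    push Not at hcon
    apply hsn
    rw [mem_map]
    have h1 : {F : Finset G | F.Nonempty} ∈ folnerFilter G :=
      mem_inf_of_left (mem_principal_self _)
    filter_upwards [ht, h1] with F hF1 hF2 using hcon F hF1 hF2
  let J := {t : Set (Finset G) // t ∈ folnerFilter G}ᵒᵈ
  have hdir : IsDirected J (· ≤ ·) := ⟨fun a b =>
    ⟨OrderDual.toDual ⟨(OrderDual.ofDual a).1 ∩ (OrderDual.ofDual b).1,
      inter_mem (OrderDual.ofDual a).2 (OrderDual.ofDual b).2⟩,
      show (OrderDual.ofDual a).1 ∩ (OrderDual.ofDual b).1 ⊆ (OrderDual.ofDual a).1 from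
        inter_subset_left,
      show (OrderDual.ofDual a).1 ∩ (OrderDual.ofDual b).1 ⊆ (OrderDual.ofDual b).1 from
        inter_subset_right⟩⟩
  have hJ : Nonempty J := ⟨OrderDual.toDual ⟨univ, univ_mem⟩⟩
  choose F hF1 hF2 hF3 using
    fun j : J => hfin (OrderDual.ofDual j).1 (OrderDual.ofDual j).2
  have hnet : IsFolnerNet F := by
    rw [isFolnerNet_iff hF2]
    intro t ht
    refine mem_map.2 (mem_of_superset (mem_atTop (OrderDual.toDual ⟨t, ht⟩ : J)) ?_)
    intro j hj
    have hj' : (OrderDual.ofDual j).1 ⊆ t := hj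
    exact hj' (hF1 j)
  obtain ⟨j, hj⟩ := ((h J F hnet).eventually hs).exists
  exact hF3 j hj

end Entropy

section Dynamics

/-- The action of `G` on the uniform space `X` is expansive: there is an entourage `U` such that
any two distinct points are moved out of `U` by some element of `G`. -/
def IsExpansive (G : Type u) [Group G] (X : Type v) [UniformSpace X] [MulAction G X] : Prop :=
  ∃ U ∈ 𝓤 X, ∀ x y : X, x ≠ y → ∃ g : G, (g • x, g • y) ∉ U

/-- The weak specification property of the action of `G` on the uniform space `X`. -/
def WeakSpecification (G : Type u) [Group G] (X : Type v) [UniformSpace X] [MulAction G X] :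
    Prop :=
  ∀ U ∈ 𝓤 X, ∃ Λ : Finset G,
    ∀ (I : Type) [Finite I] (Ω : I → Finset G),
      (∀ j k : I, j ≠ k → (Ω j : Set G) ∩ ((Λ : Set G) * (Ω k : Set G)) = ∅) →
      ∀ x : I → X, ∃ z : X, ∀ i : I, ∀ g ∈ Ω i, (g • z, g • x i) ∈ U

end Dynamics

end AmenableEntropy

/-! Expansiveness makes the entropy of `Y` visible at one scale: for a finite open cover `γ` of `Y`
by small sets, `topEntropy G Y ≤ coverEntropy G γ` (`exists_finset_dynJoin_refines`,
`coverEntropy_le_of_dynJoin_refines`). It remains to find a cover `β` of `X` whose entropy is larger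
by a positive constant.

Fix a point `p` of `X` outside `Y`. Let `K` be the gap set from specification, `c = |γ|`, and `S` a
`K`-separated subset of `F` with `|S| ≥ |F| / |K|`. For each `A ⊆ S`, take `N(γ^(F \ KA))` points of
`Y` separated on `F \ KA`, and shadow each on `F \ KA` by a point of `X` that visits `p` at the
times in `A`. The visits to `p` reveal `A`, since orbits in `Y` stay away from `p`; so all these
points are told apart by `β` on `F` (`sum_minCard_le_minCard_dynJoin`).

Forgetting `KA` costs a factor of at most `c^(|K||A|)`, so summing over `A` gives `N(β^F) ≥ N(γ^F)
(1 + c^(-|K|))^|S|`. The entropy gain is at least `log (1 + c^(-|K|)) / |K| > 0`, and it is strict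
because `coverEntropy G γ` is finite. -/

namespace AmenableEntropy

/-! ### Minimal subcovers -/

section Covers

variable {X : Type v}

theorem exists_subcover_encard_eq_minCard {α : Set (Set X)} (hα : ⋃₀ α = univ) :
    ∃ β ⊆ α, ⋃₀ β = univ ∧ β.encard = minCard α := by
  have : Nonempty {β : Set (Set X) | β ⊆ α ∧ ⋃₀ β = univ} := ⟨⟨α, subset_rfl, hα⟩⟩
  obtain ⟨⟨β, hβ⟩, h⟩ := ENat.exists_eq_iInf
    (fun β : {β : Set (Set X) | β ⊆ α ∧ ⋃₀ β = univ} => β.1.encard)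
  refine ⟨β, hβ.1, hβ.2, ?_⟩
  rw [minCard, ← iInf_subtype'']
  exact h

theorem minCard_le_encard {α β : Set (Set X)} (hβ : ⋃₀ β = univ)
    (h : ∀ B ∈ β, ∃ A ∈ α, B ⊆ A) : minCard α ≤ β.encard := by
  choose! f hf hsub using h
  refine (iInf₂_le (f '' β) ⟨image_subset_iff.2 hf, ?_⟩).trans (encard_image_le f β)
  refine eq_univ_of_forall fun x => ?_
  obtain ⟨B, hB, hx⟩ := (hβ.symm ▸ mem_univ x : x ∈ ⋃₀ β)
  exact ⟨f B, mem_image_of_mem f hB, hsub B hB hx⟩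

theorem minCard_le_of_refines {α β : Set (Set X)} (h : ∀ B ∈ β, ∃ A ∈ α, B ⊆ A) :
    minCard α ≤ minCard β :=
  le_iInf₂ fun _ hγ => minCard_le_encard hγ.2 fun B hB => h B (hγ.1 hB)

theorem one_le_minCard [Nonempty X] (α : Set (Set X)) : 1 ≤ minCard α := by
  refine le_iInf₂ fun β hβ => ?_
  rw [one_le_encard_iff_nonempty]
  obtain ⟨x⟩ := ‹Nonempty X›
  obtain ⟨B, hB, -⟩ := (hβ.2.symm ▸ mem_univ x : x ∈ ⋃₀ β)
  exact ⟨B, hB⟩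

theorem minCard_eq_zero_of_isEmpty [IsEmpty X] (α : Set (Set X)) : minCard α = 0 :=
  le_antisymm ((minCard_le_encard (β := ∅) (Subsingleton.elim _ _) (by simp)).trans (by simp))
    zero_le

end Covers

/-! ### Dynamical joins and separated sets -/

section Joins

variable {G : Type u} [Group G] {X : Type v} [MulAction G X]

theorem dynJoin_cover {α : Set (Set X)} (hα : ⋃₀ α = univ) (F : Finset G) :
    ⋃₀ dynJoin α F = univ := by
  refine eq_univ_of_forall fun x => ?_
  have h : ∀ g : G, ∃ A ∈ α, g • x ∈ A := fun g => (hα.symm ▸ mem_univ _ : g • x ∈ ⋃₀ α)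
  choose A hA hx using h
  refine ⟨_, ⟨A, fun g _ => hA g, rfl⟩, ?_⟩
  simpa [mem_inv_smul_set_iff] using fun g _ => hx g

theorem minCard_dynJoin_mono {α : Set (Set X)} {F F' : Finset G} (h : F ⊆ F') :
    minCard (dynJoin α F) ≤ minCard (dynJoin α F') := by
  refine minCard_le_of_refines ?_
  rintro _ ⟨A, hA, rfl⟩
  exact ⟨_, ⟨A, fun g hg => hA g (h hg), rfl⟩, biInter_subset_biInter_left h⟩

theorem minCard_dynJoin_insert_le [DecidableEq G] {α : Set (Set X)} (hα : ⋃₀ α = univ)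
    (F : Finset G) (g : G) :
    minCard (dynJoin α (insert g F)) ≤ minCard (dynJoin α F) * α.encard := by
  obtain ⟨β, hβ, hcov, hcard⟩ := exists_subcover_encard_eq_minCard (dynJoin_cover hα F)
  rw [← hcard, ← encard_prod]
  refine le_trans (minCard_le_encard (β := (fun p : Set X × Set X => p.1 ∩ g⁻¹ • p.2) ''
    (β ×ˢ α)) ?_ ?_) (encard_image_le _ _)
  · refine eq_univ_of_forall fun x => ?_
    obtain ⟨B, hB, hxB⟩ := (hcov.symm ▸ mem_univ x : x ∈ ⋃₀ β)
    obtain ⟨A, hA, hxA⟩ := (hα.symm ▸ mem_univ (g • x) : g • x ∈ ⋃₀ α)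
    exact ⟨_, ⟨(B, A), ⟨hB, hA⟩, rfl⟩, hxB, mem_inv_smul_set_iff.2 hxA⟩
  · rintro _ ⟨⟨B, A⟩, ⟨hB, hA⟩, rfl⟩
    obtain ⟨C, hC, rfl⟩ := hβ hB
    by_cases hg : g ∈ F
    · rw [Finset.insert_eq_of_mem hg]
      exact ⟨_, ⟨C, hC, rfl⟩, inter_subset_left⟩
    refine ⟨_, ⟨Function.update C g A, fun f hf => ?_, rfl⟩, fun x hx => ?_⟩
    · rcases Finset.mem_insert.1 hf with rfl | hf
      · simpa using hA
      · rw [Function.update_of_ne (ne_of_mem_of_not_mem hf hg)]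
        exact hC f hf
    · refine mem_iInter₂.2 fun f hf => ?_
      rcases Finset.mem_insert.1 hf with rfl | hf
      · simpa using hx.2
      · rw [Function.update_of_ne (ne_of_mem_of_not_mem hf hg)]
        exact mem_iInter₂.1 hx.1 f hf

/-- Each extra time multiplies the count by at most `|α|`. This bounds both the Følner boundary `KF
\ F` and the loss from deleting the windows `KA`. -/
theorem minCard_dynJoin_union_le [DecidableEq G] {α : Set (Set X)} (hα : ⋃₀ α = univ)
    (F B : Finset G) :
    minCard (dynJoin α (B ∪ F)) ≤ minCard (dynJoin α F) * α.encard ^ B.card := by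
  induction B using Finset.induction_on with
  | empty => simp
  | insert g B hg ih =>
    rw [Finset.insert_union, Finset.card_insert_of_notMem hg, pow_succ, ← mul_assoc]
    exact (minCard_dynJoin_insert_le hα _ g).trans (mul_le_mul_left ih _)

theorem minCard_dynJoin_le_pow {α : Set (Set X)} (hα : ⋃₀ α = univ) (F : Finset G) :
    minCard (dynJoin α F) ≤ α.encard ^ F.card := by
  classical
  have h := minCard_dynJoin_union_le hα ∅ F
  have h0 : minCard (dynJoin α (∅ : Finset G)) ≤ 1 := by
    refine (minCard_le_encard (β := {univ}) (by simp) ?_).trans (by simp)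
    rintro _ rfl
    exact ⟨_, ⟨fun _ => ∅, by simp, rfl⟩, by simp⟩
  rw [Finset.union_empty] at h
  exact h.trans ((mul_le_mul_left h0 _).trans (one_mul _).le)

/-- For `f ∈ F`, translation by `f` sends a member of the join of `γ` over `K * F` into a member of
the join over `K`, hence into a member of `α`. -/
theorem minCard_dynJoin_mul_le [DecidableEq G] {α γ : Set (Set X)} {K : Finset G}
    (h : ∀ B ∈ dynJoin γ K, ∃ A ∈ α, B ⊆ A) (F : Finset G) :
    minCard (dynJoin α F) ≤ minCard (dynJoin γ (K * F)) := by
  refine minCard_le_of_refines ?_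
  rintro _ ⟨C, hC, rfl⟩
  have h' : ∀ f ∈ F, ∃ A ∈ α, (⋂ k ∈ K, k⁻¹ • C (k * f)) ⊆ A := fun f hf =>
    h _ ⟨fun k => C (k * f), fun k hk => hC _ (Finset.mul_mem_mul hk hf), rfl⟩
  choose! A hA hsub using h'
  refine ⟨_, ⟨A, hA, rfl⟩, fun x hx => mem_iInter₂.2 fun f hf => ?_⟩
  rw [mem_inv_smul_set_iff]
  refine hsub f hf (mem_iInter₂.2 fun k hk => mem_inv_smul_set_iff.2 ?_)
  have := mem_iInter₂.1 hx (k * f) (Finset.mul_mem_mul hk hf)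
  rwa [mem_inv_smul_set_iff, mul_smul] at this

/-- A family of points separated on `F` at the scale of the members of `β` is at most as large
as any subcover of the join of `β` over `F`. -/
theorem card_le_minCard_dynJoin {ι : Type*} (s : Finset ι) (T : ι → X) {U : Set (X × X)}
    {β : Set (Set X)} (hβ : ∀ B ∈ β, B ×ˢ B ⊆ U) (F : Finset G)
    (hT : ∀ i ∈ s, ∀ j ∈ s, (∀ g ∈ F, (g • T i, g • T j) ∈ U) → i = j) :
    (s.card : ℕ∞) ≤ minCard (dynJoin β F) := by
  refine le_iInf₂ fun γ hγ => ?_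
  have h : ∀ i, ∃ C ∈ γ, T i ∈ C := fun i => (hγ.2.symm ▸ mem_univ _ : T i ∈ ⋃₀ γ)
  choose C hC hTC using h
  rw [← encard_coe_eq_coe_finsetCard]
  refine encard_le_encard_of_injOn (f := C) (fun i _ => hC i) fun i hi j hj hij =>
    hT i hi j hj fun g hg => ?_
  obtain ⟨A, hA, hCA⟩ := hγ.1 (hC i)
  refine hβ _ (hA g hg) ⟨?_, ?_⟩
  · have := hTC i
    rw [hCA] at this
    exact mem_inv_smul_set_iff.1 (mem_iInter₂.1 this g hg)
  · have := hTC j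
    rw [← hij, hCA] at this
    exact mem_inv_smul_set_iff.1 (mem_iInter₂.1 this g hg)

/-- If `V` is a Lebesgue entourage of `α`, there are `V`-separated sets on `F` of every
cardinality up to the minimal one of subcovers of the join of `α` over `F`. -/
theorem exists_separated_finset {α : Set (Set X)} {V : Set (X × X)}
    (hrefl : ∀ x, (x, x) ∈ V) (hsymm : ∀ x y, (x, y) ∈ V → (y, x) ∈ V)
    (hV : ∀ x, ∃ A ∈ α, ∀ y, (x, y) ∈ V → y ∈ A) (F : Finset G) (n : ℕ)
    (hn : (n : ℕ∞) ≤ minCard (dynJoin α F)) :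
    ∃ E : Finset X, E.card = n ∧
      ∀ x ∈ E, ∀ y ∈ E, (∀ g ∈ F, (g • x, g • y) ∈ V) → x = y := by
  classical
  induction n with
  | zero => exact ⟨∅, by simp⟩
  | succ n ih =>
    obtain ⟨E, hE, hsep⟩ := ih (le_trans (by exact_mod_cast n.le_succ) hn)
    choose A hA hVA using hV
    -- The sets `B x` are members of the join; too few of them to cover `X`, they miss some `y`,
    -- which is then separated from all of `E`.
    let B : X → Set X := fun x => ⋂ g ∈ F, g⁻¹ • A (g • x)
    have hex : ∃ y, ∀ x ∈ E, y ∉ B x := by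
      by_contra! hcon
      have hle : minCard (dynJoin α F) ≤ (B '' (E : Set X)).encard := by
        refine minCard_le_encard (eq_univ_of_forall fun y => ?_) ?_
        · obtain ⟨x, hx, hy⟩ := hcon y
          exact ⟨_, ⟨x, hx, rfl⟩, hy⟩
        · rintro _ ⟨x, -, rfl⟩
          exact ⟨_, ⟨fun g => A (g • x), fun g _ => hA _, rfl⟩, subset_rfl⟩
      have := (hn.trans hle).trans (encard_image_le _ _)
      rw [encard_coe_eq_coe_finsetCard, hE] at this
      exact absurd (Nat.cast_le.1 this) (by omega)
    obtain ⟨y, hy⟩ := hex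
    have key : ∀ x ∈ E, ¬ ∀ g ∈ F, (g • x, g • y) ∈ V := fun x hx h =>
      hy x hx (mem_iInter₂.2 fun g hg => mem_inv_smul_set_iff.2 (hVA _ _ (h g hg)))
    have hyE : y ∉ E := fun h => key y h fun g _ => hrefl _
    refine ⟨insert y E, by rw [Finset.card_insert_of_notMem hyE, hE], fun a ha b hb hab => ?_⟩
    rcases Finset.mem_insert.1 ha with rfl | haE <;> rcases Finset.mem_insert.1 hb with rfl | hbE
    · rfl
    · exact absurd (fun g hg => hsymm _ _ (hab g hg)) (key b hbE)
    · exact absurd hab (key a haE)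
    · exact hsep a haE b hbE hab

end Joins

/-! ### Entourages, Lebesgue numbers and expansiveness -/

section Scales

variable {X : Type v} [UniformSpace X] [CompactSpace X]

theorem exists_finiteOpenCover_subset {U : Set (X × X)} (hU : U ∈ 𝓤 X) :
    ∃ β : Set (Set X), IsFiniteOpenCover β ∧ ∀ B ∈ β, B ×ˢ B ⊆ U := by
  have h : ∀ x : X, ∃ B : Set X, IsOpen B ∧ x ∈ B ∧ B ×ˢ B ⊆ U := by
    intro x
    obtain ⟨V, hV, hsymm, hVU⟩ := comp_symm_mem_uniformity_sets hU
    refine ⟨interior (UniformSpace.ball x V), isOpen_interior,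
      mem_interior_iff_mem_nhds.2 (UniformSpace.ball_mem_nhds x hV), ?_⟩
    rintro ⟨a, b⟩ ⟨ha, hb⟩
    exact hVU ⟨x, hsymm.symm _ _ (interior_subset (s := UniformSpace.ball x V) ha),
      interior_subset (s := UniformSpace.ball x V) hb⟩
  choose B hBo hxB hBU using h
  obtain ⟨t, ht⟩ := isCompact_univ.elim_finite_subcover B hBo
    fun x _ => mem_iUnion.2 ⟨x, hxB x⟩
  refine ⟨B '' t, ⟨t.finite_toSet.image B, ?_, ?_⟩, ?_⟩
  · rintro _ ⟨x, -, rfl⟩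
    exact hBo x
  · rw [sUnion_image]
    exact univ_subset_iff.1 ht
  · rintro _ ⟨x, -, rfl⟩
    exact hBU x

theorem IsFiniteOpenCover.exists_lebesgue {α : Set (Set X)} (hα : IsFiniteOpenCover α) :
    ∃ V ∈ 𝓤 X, ∀ x, ∃ A ∈ α, ∀ y, (x, y) ∈ V → y ∈ A := by
  obtain ⟨V, hV, h⟩ := lebesgue_number_lemma_sUnion isCompact_univ hα.isOpen hα.cover.ge
  refine ⟨V, hV, fun x => ?_⟩
  obtain ⟨A, hA, hsub⟩ := h x (mem_univ x)
  exact ⟨A, hA, fun y hy => hsub hy⟩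

variable {G : Type u} [Group G] [MulAction G X] [ContinuousConstSMul G X]

/-- In an expansive system, closeness along a suitable finite set of group elements at a fixed
scale forces closeness at any given scale. -/
theorem exists_finset_forall_imp_mem {U W : Set (X × X)} (hUc : IsClosed U)
    (hexp : ∀ x y : X, x ≠ y → ∃ g : G, (g • x, g • y) ∉ U) (hW : W ∈ 𝓤 X) :
    ∃ K : Finset G, ∀ x y : X, (∀ g ∈ K, (g • x, g • y) ∈ U) → (x, y) ∈ W := by
  have hcont : ∀ g : G, Continuous fun p : X × X => (g • p.1, g • p.2) := fun g => by fun_prop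
  -- This compact set misses the diagonal, so the open sets of pairs moved out of `U` by some `g`
  -- cover it, and finitely many `g` suffice.
  have hc : IsCompact (interior W)ᶜ := isOpen_interior.isClosed_compl.isCompact
  obtain ⟨K, hK⟩ := hc.elim_finite_subcover
    (fun g : G => (fun p : X × X => (g • p.1, g • p.2)) ⁻¹' Uᶜ)
    (fun g => hUc.isOpen_compl.preimage (hcont g)) (fun p hp => by
      obtain ⟨g, hg⟩ := hexp p.1 p.2 fun heq => hp (by
        have := refl_mem_uniformity (x := p.1) (interior_mem_uniformity hW)
        rwa [show p = (p.1, p.1) from Prod.ext rfl heq.symm])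
      exact mem_iUnion.2 ⟨g, hg⟩)
  refine ⟨K, fun x y hxy => ?_⟩
  by_contra hnot
  obtain ⟨g, hg, hgU⟩ := mem_iUnion₂.1 (hK (show (x, y) ∈ (interior W)ᶜ from
    fun h => hnot (interior_subset h)))
  exact hgU (hxy g hg)

/-- A cover at the expansive scale is a generator: points sharing a member of the join over `K` are
`U`-close along `K`, hence closer than a Lebesgue entourage of `α`. -/
theorem exists_finset_dynJoin_refines [Nonempty X] {U : Set (X × X)} (hUc : IsClosed U)
    (hexp : ∀ x y : X, x ≠ y → ∃ g : G, (g • x, g • y) ∉ U)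
    {γ : Set (Set X)} (hγ : ∀ B ∈ γ, B ×ˢ B ⊆ U) {α : Set (Set X)} (hα : IsFiniteOpenCover α) :
    ∃ K : Finset G, ∀ B ∈ dynJoin γ K, ∃ A ∈ α, B ⊆ A := by
  obtain ⟨W, hW, hWα⟩ := hα.exists_lebesgue
  obtain ⟨K, hK⟩ := exists_finset_forall_imp_mem hUc hexp hW
  refine ⟨K, ?_⟩
  rintro B ⟨C, hC, rfl⟩
  rcases eq_empty_or_nonempty (⋂ g ∈ K, g⁻¹ • C g) with h | ⟨x, hx⟩
  · obtain ⟨A, hA, -⟩ := hWα (Classical.arbitrary X)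
    exact ⟨A, hA, h ▸ empty_subset A⟩
  · obtain ⟨A, hA, hxA⟩ := hWα x
    refine ⟨A, hA, fun y hy => hxA y (hK x y fun g hg => hγ _ (hC g hg) ⟨?_, ?_⟩)⟩
    · exact mem_inv_smul_set_iff.1 (mem_iInter₂.1 hx g hg)
    · exact mem_inv_smul_set_iff.1 (mem_iInter₂.1 hy g hg)

end Scales

/-! ### Entropy along the Følner filter -/

section Ratios

variable {G : Type u} [Group G] {X : Type v} [MulAction G X]

theorem logCardRatio_eq_coe {α : Set (Set X)} {F : Finset G} {n : ℕ} (hn : 1 ≤ n)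
    (h : minCard (dynJoin α F) = n) :
    logCardRatio α F = ((Real.log n / F.card : ℝ) : EReal) := by
  rw [logCardRatio, h, ENat.toENNReal_coe, EReal.coe_div, ← ENNReal.ofReal_natCast,
    ENNReal.log_ofReal_of_pos (by exact_mod_cast hn)]
  rfl

theorem folnerFilter_neBot (hG : IsAmenable G) : (folnerFilter G).NeBot := by
  obtain ⟨J, _, _, _, F, hF⟩ := hG
  exact ((isFolnerNet_iff hF.nonempty).1 hF).neBot

theorem eventually_nonempty_folnerFilter : ∀ᶠ F in folnerFilter G, F.Nonempty :=
  mem_inf_of_left (mem_principal_self _)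

theorem tendsto_folnerRatio (g : G) : Tendsto (folnerRatio g) (folnerFilter G) (𝓝 0) :=
  tendsto_iff_comap.2 (inf_le_right.trans (iInf_le _ g))

theorem card_mul_sdiff_le [DecidableEq G] (K F : Finset G) :
    (((K * F) \ F).card : ℝ) / F.card ≤ ∑ k ∈ K, folnerRatio k F := by
  simp only [folnerRatio, ← Finset.sum_div]
  gcongr
  have : (K * F) \ F ⊆ K.biUnion fun k => (k • F) \ F := by
    intro x hx
    obtain ⟨hx, hxF⟩ := Finset.mem_sdiff.1 hx
    obtain ⟨k, hk, f, hf, rfl⟩ := Finset.mem_mul.1 hx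
    exact Finset.mem_biUnion.2 ⟨k, hk, Finset.mem_sdiff.2 ⟨Finset.smul_mem_smul_finset hf, hxF⟩⟩
  calc (((K * F) \ F).card : ℝ) ≤ ((∑ k ∈ K, ((k • F) \ F).card : ℕ) : ℝ) := by
        exact_mod_cast (Finset.card_le_card this).trans Finset.card_biUnion_le
    _ = _ := by
        push_cast
        refine Finset.sum_congr rfl fun k _ => ?_
        congr!

theorem topEntropy_eq_bot_of_isEmpty (hG : IsAmenable G) [TopologicalSpace X] [IsEmpty X] :
    topEntropy G X = ⊥ := by
  have := folnerFilter_neBot hG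
  refine le_bot_iff.1 (iSup₂_le fun α _ => ?_)
  refine (limsup_congr (v := fun _ => ⊥) ?_).le.trans (limsup_const _).le
  filter_upwards [eventually_nonempty_folnerFilter] with F hF
  rw [logCardRatio, minCard_eq_zero_of_isEmpty, ENat.toENNReal_zero, ENNReal.log_zero]
  exact EReal.bot_div_of_pos_ne_top (by exact_mod_cast hF.card_pos) (by exact EReal.natCast_ne_top _)

theorem exists_minCard_dynJoin_eq_natCast [Nonempty X] {α : Set (Set X)} (hfin : α.Finite)
    (hα : ⋃₀ α = univ) (F : Finset G) :
    ∃ n : ℕ, 1 ≤ n ∧ n ≤ α.ncard ^ F.card ∧ minCard (dynJoin α F) = n := by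
  have h := minCard_dynJoin_le_pow hα F
  rw [← hfin.cast_ncard_eq] at h
  obtain ⟨n, hn⟩ := ENat.ne_top_iff_exists.1 (ne_top_of_le_ne_top (ENat.natCast_ne_top _)
    (by exact_mod_cast h : minCard (dynJoin α F) ≤ ((α.ncard ^ F.card : ℕ) : ℕ∞)))
  refine ⟨n, ?_, ?_, hn.symm⟩
  · have := one_le_minCard (dynJoin α F)
    rw [← hn] at this
    exact_mod_cast this
  · rw [← hn] at h
    exact_mod_cast h

theorem one_le_ncard_of_sUnion_eq_univ [Nonempty X] {α : Set (Set X)} (hfin : α.Finite)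
    (hα : ⋃₀ α = univ) : 1 ≤ α.ncard := by
  obtain ⟨x⟩ := ‹Nonempty X›
  obtain ⟨A, hA, -⟩ := (hα.symm ▸ mem_univ x : x ∈ ⋃₀ α)
  exact (ncard_pos hfin).2 ⟨A, hA⟩

theorem coverEntropy_nonneg (hG : IsAmenable G) [Nonempty X] (α : Set (Set X)) :
    0 ≤ coverEntropy G α := by
  have := folnerFilter_neBot hG
  refine le_limsup_of_frequently_le (Eventually.frequently (Eventually.of_forall fun F => ?_))
  have : (1 : ENNReal) ≤ (minCard (dynJoin α F) : ENNReal) := by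
    exact_mod_cast one_le_minCard (dynJoin α F)
  exact EReal.div_nonneg (ENNReal.zero_le_log_iff.2 this) (by positivity)

theorem coverEntropy_lt_top [Nonempty X] {α : Set (Set X)} (hfin : α.Finite)
    (hα : ⋃₀ α = univ) : coverEntropy G α < ⊤ := by
  refine lt_of_le_of_lt (limsup_le_of_le (a := ((Real.log α.ncard : ℝ) : EReal)) ?_ ?_)
    (EReal.coe_lt_top _)
  · isBoundedDefault
  filter_upwards [eventually_nonempty_folnerFilter] with F hF
  obtain ⟨n, h1, hn, h⟩ := exists_minCard_dynJoin_eq_natCast (G := G) hfin hα F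
  rw [logCardRatio_eq_coe h1 h, EReal.coe_le_coe_iff,
    div_le_iff₀ (by exact_mod_cast hF.card_pos), mul_comm, ← Real.log_pow]
  exact Real.log_le_log (by exact_mod_cast h1) (by exact_mod_cast hn)

/-- If the join of `γ` over a finite set refines `α`, then the entropy relative to `α` is at most
that relative to `γ`. -/
theorem coverEntropy_le_of_dynJoin_refines (hG : IsAmenable G) [Nonempty X]
    {α γ : Set (Set X)} (hαfin : α.Finite) (hα : ⋃₀ α = univ)
    (hγfin : γ.Finite) (hγ : ⋃₀ γ = univ)
    {K : Finset G} (h : ∀ B ∈ dynJoin γ K, ∃ A ∈ α, B ⊆ A) :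
    coverEntropy G α ≤ coverEntropy G γ := by
  classical
  have := folnerFilter_neBot hG
  set c : ℝ := Real.log γ.ncard with hc
  have hγ1 := one_le_ncard_of_sUnion_eq_univ hγfin hγ
  have hc0 : 0 ≤ c := Real.log_nonneg (by exact_mod_cast hγ1)
  -- Passing from `F` to `K * F` adds at most `|KF \ F|` times, each costing at most `log |γ|`; `v`
  -- bounds this error per element of `F`.
  let v : Finset G → EReal := fun F => ((c * ∑ k ∈ K, folnerRatio k F : ℝ) : EReal)
  have hv : Tendsto v (folnerFilter G) (𝓝 0) := by
    have h1 : Tendsto (fun F : Finset G => c * ∑ k ∈ K, folnerRatio k F) (folnerFilter G)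
        (𝓝 0) := by
      simpa using (tendsto_finsetSum K fun k _ => tendsto_folnerRatio k).const_mul c
    exact (continuous_coe_real_ereal.tendsto _).comp h1
  have hle : ∀ᶠ F in folnerFilter G, logCardRatio α F ≤
      ((fun F => logCardRatio γ F : Finset G → EReal) + v) F := by
    filter_upwards [eventually_nonempty_folnerFilter] with F hF
    obtain ⟨n, hn1, -, hn⟩ := exists_minCard_dynJoin_eq_natCast (G := G) hαfin hα F
    obtain ⟨m, hm1, -, hm⟩ := exists_minCard_dynJoin_eq_natCast (G := G) hγfin hγ F
    have hF0 : (0 : ℝ) < F.card := by exact_mod_cast hF.card_pos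
    have hnm : n ≤ m * γ.ncard ^ ((K * F) \ F).card := by
      have h1 := (minCard_dynJoin_mul_le h F).trans (minCard_dynJoin_mono
        (Finset.sdiff_union_self_eq_union.ge.trans' Finset.subset_union_left :
          K * F ⊆ (K * F) \ F ∪ F))
      have h2 := h1.trans (minCard_dynJoin_union_le hγ F ((K * F) \ F))
      rw [hn, hm, ← hγfin.cast_ncard_eq] at h2
      exact_mod_cast h2
    simp only [Pi.add_apply, v]
    rw [logCardRatio_eq_coe hn1 hn, logCardRatio_eq_coe hm1 hm, ← EReal.coe_add,
      EReal.coe_le_coe_iff]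
    have hlog : Real.log n ≤ Real.log m + ((K * F) \ F).card * c := by
      rw [hc, ← Real.log_pow, ← Real.log_mul (by positivity) (by positivity)]
      exact Real.log_le_log (by exact_mod_cast hn1) (by exact_mod_cast hnm)
    calc Real.log n / F.card ≤ (Real.log m + ((K * F) \ F).card * c) / F.card := by gcongr
      _ = Real.log m / F.card + c * (((K * F) \ F).card / F.card) := by ring
      _ ≤ _ := by gcongr; exact card_mul_sdiff_le K F
  calc coverEntropy G α ≤ limsup ((fun F => logCardRatio γ F) + v) (folnerFilter G) :=
        limsup_le_limsup hle
    _ ≤ coverEntropy G γ + limsup v (folnerFilter G) := EReal.limsup_add_le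
        (Or.inr (by rw [hv.limsup_eq]; exact EReal.zero_ne_top))
        (Or.inr (by rw [hv.limsup_eq]; exact EReal.zero_ne_bot))
    _ = coverEntropy G γ := by rw [hv.limsup_eq, add_zero]

/-- A gain uniform in `F` passes to the upper limit, so existence of the limit is not needed. -/
theorem coverEntropy_add_le {Z : Type v} [MulAction G Z] {α : Set (Set Z)} {β : Set (Set X)}
    (hG : IsAmenable G) {δ : ℝ}
    (h : ∀ F : Finset G, F.Nonempty → logCardRatio α F + (δ : EReal) ≤ logCardRatio β F) :
    coverEntropy G α + (δ : EReal) ≤ coverEntropy G β := by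
  have := folnerFilter_neBot hG
  have h1 := EReal.le_limsup_add (f := folnerFilter G) (u := fun F => logCardRatio α F)
    (v := fun _ => (δ : EReal))
  rw [liminf_const] at h1
  refine h1.trans (limsup_le_limsup ?_)
  filter_upwards [eventually_nonempty_folnerFilter] with F hF using h F hF

end Ratios

/-! ### Separated subsets of a finite set -/

section Counting

variable {G : Type u} [Group G]

/-- A maximal `K`-separated subset of `F` has at least `|F| / |K|` elements. -/
theorem exists_separated_subset [DecidableEq G] (K : Finset G) (h1 : 1 ∈ K)
    (hinv : ∀ g ∈ K, g⁻¹ ∈ K) (F : Finset G) :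
    ∃ S ⊆ F, (∀ s ∈ S, ∀ t ∈ S, s ∈ K * {t} → s = t) ∧ F.card ≤ K.card * S.card := by
  suffices h : ∃ S ⊆ F, (∀ s ∈ S, ∀ t ∈ S, s ∈ K * {t} → s = t) ∧ F ⊆ K * S by
    obtain ⟨S, hSF, hS, hF⟩ := h
    exact ⟨S, hSF, hS, (Finset.card_le_card hF).trans Finset.card_mul_le⟩
  induction F using Finset.induction_on with
  | empty => exact ⟨∅, by simp⟩
  | insert g F hg ih =>
    obtain ⟨S, hSF, hS, hF⟩ := ih
    by_cases hgS : g ∈ K * S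
    · exact ⟨S, hSF.trans (Finset.subset_insert _ _), hS, Finset.insert_subset hgS hF⟩
    have hnot : ∀ t ∈ S, g ∉ K * {t} := fun t ht h =>
      hgS (Finset.mul_subset_mul_left (Finset.singleton_subset_iff.2 ht) h)
    refine ⟨insert g S, Finset.insert_subset_insert g hSF, fun s hs t ht hst => ?_,
      Finset.insert_subset ?_ (hF.trans (Finset.mul_subset_mul_left (Finset.subset_insert _ _)))⟩
    · rcases Finset.mem_insert.1 hs with rfl | hsS <;> rcases Finset.mem_insert.1 ht with rfl | htS
      · rfl
      · exact absurd hst (hnot t htS)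
      · refine absurd ?_ (hnot s hsS)
        obtain ⟨k, hk, x, hx, rfl⟩ := Finset.mem_mul.1 hst
        obtain rfl := Finset.mem_singleton.1 hx
        exact Finset.mem_mul.2 ⟨k⁻¹, hinv k hk, k * x, Finset.mem_singleton_self _, by group⟩
      · exact hS s hsS t htS hst
    · exact Finset.mem_mul.2 ⟨1, h1, g, Finset.mem_insert_self _ _, one_mul g⟩

end Counting

/-! ### Specification and the counting of patterns -/

section Specification

variable {G : Type u} [Group G] {X : Type v} [MulAction G X]

/-- The blocks are `Ω` and the singletons `{s}`, `s ∈ A`, with target `s⁻¹ • p` at `s`. Symmetrizing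
`Λ` to `K` gives the disjointness of blocks in both orders. -/
theorem WeakSpecification.exists_shadow [DecidableEq G] [UniformSpace X]
    (hX : WeakSpecification G X) {U : Set (X × X)} (hU : U ∈ 𝓤 X) :
    ∃ K : Finset G, 1 ∈ K ∧ (∀ g ∈ K, g⁻¹ ∈ K) ∧
      ∀ (A Ω : Finset G), (∀ s ∈ A, ∀ t ∈ A, s ∈ K * {t} → s = t) → Disjoint Ω (K * A) →
      ∀ p y : X, ∃ z : X, (∀ s ∈ A, (s • z, p) ∈ U) ∧ ∀ g ∈ Ω, (g • z, g • y) ∈ U := by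
  obtain ⟨Λ, hΛ⟩ := hX U hU
  refine ⟨Λ ∪ Λ⁻¹ ∪ {1}, by simp, fun g hg => ?_, fun A Ω hA hΩ p y => ?_⟩
  · simp only [Finset.mem_union, Finset.mem_inv', Finset.mem_singleton, inv_inv, inv_eq_one] at hg ⊢
    tauto
  have hmem : ∀ s l t : G, l ∈ Λ → s = l * t → s ∈ (Λ ∪ Λ⁻¹ ∪ {1}) * {t} := by
    rintro s l t hl rfl
    exact Finset.mul_mem_mul (by simp [hl]) (Finset.mem_singleton_self t)
  let e := A.equivFin
  let Ω' : Option (Fin A.card) → Finset G := fun i => i.elim Ω fun i => {(e.symm i : G)}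
  have hdisj : ∀ j k, j ≠ k → (Ω' j : Set G) ∩ ((Λ : Set G) * (Ω' k : Set G)) = ∅ := by
    intro j k hjk
    rw [← Set.disjoint_iff_inter_eq_empty, Set.disjoint_left]
    rintro x hx ⟨l, hl, w, hw, rfl⟩
    rcases j with _ | j <;> rcases k with _ | k
    · exact hjk rfl
    · simp only [Ω', Option.elim, Finset.mem_coe, Finset.mem_singleton] at hx hw hl
      refine Finset.disjoint_left.1 hΩ hx (Finset.mul_mem_mul (by simp [hl]) ?_)
      rw [hw]
      exact (e.symm k).2
    · simp only [Ω', Option.elim, Finset.mem_coe, Finset.mem_singleton] at hx hw hl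
      refine Finset.disjoint_left.1 hΩ hw ?_
      rw [show w = l⁻¹ * (l * w) by group]
      refine Finset.mul_mem_mul (by simp [hl]) ?_
      rw [hx]
      exact (e.symm j).2
    · simp only [Ω', Option.elim, Finset.mem_coe, Finset.mem_singleton] at hx hw hl
      refine hjk (congrArg some (e.symm.injective (Subtype.ext ?_)))
      exact hA _ (e.symm j).2 _ (e.symm k).2 (hmem _ l _ hl (by rw [← hx, ← hw]))
  obtain ⟨z, hz⟩ := hΛ _ Ω' hdisj (fun i => i.elim y fun i => (e.symm i : G)⁻¹ • p)
  refine ⟨z, fun s hs => ?_, fun g hg => hz none g hg⟩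
  have := hz (some (e ⟨s, hs⟩)) s (by simp [Ω'])
  simpa using this

/-- Specification lets one replace a point of `Y` by a point `p` outside of `Y` at an arbitrary
subset of a separated set `S`; all the points so obtained are distinguished by `β` on `F`. -/
theorem sum_minCard_le_minCard_dynJoin [DecidableEq G] {Y : SubMulAction G X}
    {U V : Set (X × X)} (hsymm : ∀ x y, (x, y) ∈ U → (y, x) ∈ U)
    {p : X} (hp : ∀ y ∈ Y, ∀ a b, (p, a) ∈ U → (a, b) ∈ U → (b, y) ∉ U)
    (hVrefl : ∀ x, (x, x) ∈ V) (hVsymm : ∀ x y, (x, y) ∈ V → (y, x) ∈ V)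
    (hUV : ∀ x a b y, (x, a) ∈ U → (a, b) ∈ U → (b, y) ∈ U → (x, y) ∈ V)
    {α : Set (Set Y)} (hα : ∀ x : Y, ∃ A ∈ α, ∀ y : Y, ((x : X), (y : X)) ∈ V → y ∈ A)
    {β : Set (Set X)} (hβ : ∀ B ∈ β, B ×ˢ B ⊆ U) {K F S : Finset G} (hSF : S ⊆ F)
    (hS : ∀ s ∈ S, ∀ t ∈ S, s ∈ K * {t} → s = t)
    (hspec : ∀ (A Ω : Finset G), (∀ s ∈ A, ∀ t ∈ A, s ∈ K * {t} → s = t) → Disjoint Ω (K * A) →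
      ∀ p y : X, ∃ z : X, (∀ s ∈ A, (s • z, p) ∈ U) ∧ ∀ g ∈ Ω, (g • z, g • y) ∈ U)
    (n : Finset G → ℕ) (hn : ∀ F', minCard (dynJoin α F') = n F') :
    ((∑ A ∈ S.powerset, n (F \ (K * A)) : ℕ) : ℕ∞) ≤ minCard (dynJoin β F) := by
  have hE : ∀ A : Finset G, ∃ E : Finset Y, E.card = n (F \ (K * A)) ∧ ∀ x ∈ E, ∀ y ∈ E,
      (∀ g ∈ F \ (K * A), (g • x, g • y) ∈ {q : Y × Y | ((q.1 : X), (q.2 : X)) ∈ V}) → x = y :=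
    fun A => exists_separated_finset (X := Y) (fun x => hVrefl _) (fun x y => hVsymm _ _) hα _ _ (hn _).ge
  choose E hEcard hEsep using hE
  have hz : ∀ i : (_ : Finset G) × Y, ∃ z : X, i.1 ⊆ S →
      (∀ s ∈ i.1, (s • z, p) ∈ U) ∧ ∀ g ∈ F \ (K * i.1), (g • z, g • (i.2 : X)) ∈ U := by
    rintro ⟨A, y⟩
    by_cases hA : A ⊆ S
    · obtain ⟨z, hz⟩ := hspec A (F \ (K * A)) (fun s hs t ht => hS s (hA hs) t (hA ht))
        Finset.sdiff_disjoint p y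
      exact ⟨z, fun _ => hz⟩
    · exact ⟨p, fun h => absurd h hA⟩
  choose z hz using hz
  have hsub : ∀ i j : (_ : Finset G) × Y, i.1 ⊆ S → j.1 ⊆ S →
      (∀ g ∈ F, (g • z i, g • z j) ∈ U) → i.1 ⊆ j.1 := by
    intro i j hi hj hij s hs
    by_contra hsj
    have hsK : s ∈ F \ (K * j.1) := by
      refine Finset.mem_sdiff.2 ⟨hSF (hi hs), fun hmem => hsj ?_⟩
      obtain ⟨k, hk, t, ht, rfl⟩ := Finset.mem_mul.1 hmem
      rw [hS _ (hi hs) t (hj ht) (Finset.mul_mem_mul hk (Finset.mem_singleton_self t))]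
      exact ht
    -- At a time `s` in the first subset but not the second, one shadow is near `p` and the other
    -- near `Y`; their closeness would link `p` to `Y` in three `U`-steps.
    exact hp (s • (j.2 : X)) (Y.smul_mem s j.2.2) _ _ (hsymm _ _ ((hz i hi).1 s hs))
      (hij s (hSF (hi hs))) ((hz j hj).2 s hsK)
  have hcard : ∑ A ∈ S.powerset, n (F \ (K * A)) = (S.powerset.sigma E).card := by
    rw [Finset.card_sigma]
    exact Finset.sum_congr rfl fun A _ => (hEcard A).symm
  rw [hcard]
  refine card_le_minCard_dynJoin _ z hβ F ?_
  rintro ⟨A, y⟩ hi ⟨B, y'⟩ hj hij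
  obtain ⟨hA, hy⟩ := Finset.mem_sigma.1 hi
  obtain ⟨hB, hy'⟩ := Finset.mem_sigma.1 hj
  rw [Finset.mem_powerset] at hA hB
  obtain rfl : A = B := Finset.Subset.antisymm (hsub _ _ hA hB hij)
    (hsub _ _ hB hA fun g hg => hsymm _ _ (hij g hg))
  -- With the same subset `A`, `y` and `y'` are linked through their shadows in three `U`-steps at
  -- each time of `F \ KA`, hence `V`-close there.
  obtain rfl : y = y' := hEsep A y hy y' hy' fun g hg =>
    hUV _ _ _ _ (hsymm _ _ ((hz ⟨A, y⟩ hA).2 g hg)) (hij g (Finset.mem_sdiff.1 hg).1)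
      ((hz ⟨A, y'⟩ hB).2 g hg)
  rfl

end Specification

/-- The growth in the number of patterns gained by free choices on a separated set. -/
theorem mul_pow_le_sum {G : Type u} [Group G] [DecidableEq G] {K F S : Finset G} {n : Finset G → ℕ}
    {c : ℕ} (hc : 1 ≤ c)
    (hn : ∀ A, n F ≤ n (F \ (K * A)) * c ^ (K * A).card) :
    (n F : ℝ) * (((c : ℝ) ^ K.card)⁻¹ + 1) ^ S.card ≤
      ((∑ A ∈ S.powerset, n (F \ (K * A)) : ℕ) : ℝ) := by
  have hc' : (1 : ℝ) ≤ c := by exact_mod_cast hc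
  -- Binomial expansion over subsets: `A` contributes `(c ^ |K|)⁻¹ ^ |A|`.
  rw [← Finset.sum_pow_mul_eq_add_pow, Finset.mul_sum]
  push_cast
  refine Finset.sum_le_sum fun A _ => ?_
  rw [one_pow, mul_one, inv_pow, ← pow_mul, ← div_eq_mul_inv, div_le_iff₀ (by positivity)]
  calc (n F : ℝ) ≤ n (F \ (K * A)) * (c : ℝ) ^ (K * A).card := by exact_mod_cast hn A
    _ ≤ _ := by gcongr; exact Finset.card_mul_le

end AmenableEntropy

/-! ### The strict inequality of entropies -/

open AmenableEntropy in
theorem theoremt {G : Type u} [Group G] (hG : AmenableEntropy.IsAmenable G)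
    {X : Type v} [UniformSpace X] [CompactSpace X] [T2Space X]
    [MulAction G X] [ContinuousConstSMul G X]
    (hX : AmenableEntropy.WeakSpecification G X)
    (Y : SubMulAction G X) (hYclosed : IsClosed (Y : Set X)) (hYproper : (Y : Set X) ≠ Set.univ)
    (hYexp : AmenableEntropy.IsExpansive G Y) :
    AmenableEntropy.topEntropy G Y < AmenableEntropy.topEntropy G X := by
  classical
  obtain ⟨p, hpY⟩ := (ne_univ_iff_exists_notMem _).1 hYproper
  have : Nonempty X := ⟨p⟩
  rcases isEmpty_or_nonempty Y with hY | hY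
  · rw [topEntropy_eq_bot_of_isEmpty hG]
    have huniv : IsFiniteOpenCover ({univ} : Set (Set X)) :=
      ⟨finite_singleton _, by simp, by simp⟩
    exact EReal.bot_lt_zero.trans_le ((coverEntropy_nonneg hG _).trans
      (le_iSup₂ (f := fun α _ => coverEntropy G α) {univ} huniv))
  have : CompactSpace Y := isCompact_iff_compactSpace.1 hYclosed.isCompact
  have : ContinuousConstSMul G Y :=
    ⟨fun g => ((continuous_const_smul g).comp continuous_subtype_val).subtype_mk _⟩
  obtain ⟨U₀, hU₀, hexp₀⟩ := hYexp
  obtain ⟨U₁, hU₁, hU₁c, hU₁₀⟩ := mem_uniformity_isClosed hU₀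
  have hexp : ∀ x y : Y, x ≠ y → ∃ g : G, (g • x, g • y) ∉ U₁ := fun x y hxy =>
    (hexp₀ x y hxy).imp fun g hg h => hg (hU₁₀ h)
  obtain ⟨γ, hγ, hγU⟩ := exists_finiteOpenCover_subset hU₁
  obtain ⟨V₀, hV₀, hγV₀⟩ := hγ.exists_lebesgue
  rw [uniformity_subtype, mem_comap] at hV₀
  obtain ⟨V₁, hV₁, hV₁₀⟩ := hV₀
  obtain ⟨V, hV, hVsymm, hVV₁⟩ := comp_symm_mem_uniformity_sets hV₁
  have hVV : V ⊆ V₁ := fun q hq => hVV₁ ⟨q.2, hq, refl_mem_uniformity hV⟩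
  obtain ⟨W, hW, hpW⟩ : ∃ W ∈ 𝓤 X, ∀ y ∈ Y, (p, y) ∉ W := by
    obtain ⟨W, hW, hsub⟩ := UniformSpace.mem_nhds_iff.1 (hYclosed.isOpen_compl.mem_nhds hpY)
    exact ⟨W, hW, fun y hy h => hsub h hy⟩
  -- Three `U`-steps stay in `V`, a Lebesgue scale for `γ`, and in `W`, which separates `p` from
  -- `Y`.
  obtain ⟨U, hU, hUsymm, hUVW⟩ := comp_comp_symm_mem_uniformity_sets (inter_mem hV hW)
  have hU3 : ∀ x a b y, (x, a) ∈ U → (a, b) ∈ U → (b, y) ∈ U → (x, y) ∈ V ∩ W :=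
    fun x a b y h1 h2 h3 => hUVW ⟨b, ⟨a, h1, h2⟩, h3⟩
  obtain ⟨β, hβ, hβU⟩ := exists_finiteOpenCover_subset hU
  obtain ⟨K, hK1, hKinv, hspec⟩ := hX.exists_shadow hU
  choose n hn1 hnle hn using exists_minCard_dynJoin_eq_natCast (G := G) hγ.finite hγ.cover
  set c := γ.ncard with hc
  have hc1 : 1 ≤ c := one_le_ncard_of_sUnion_eq_univ hγ.finite hγ.cover
  set q : ℝ := ((c : ℝ) ^ K.card)⁻¹ + 1 with hq
  have hq1 : 1 < q := by
    have : 0 < ((c : ℝ) ^ K.card)⁻¹ := by positivity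
    linarith
  have hK0 : (0 : ℝ) < K.card := by exact_mod_cast Finset.card_pos.2 ⟨1, hK1⟩
  have hlogq := Real.log_pos hq1
  -- Each element of `S` gains `log q`, and `|S| / |F| ≥ 1 / |K|`.
  have hgap : coverEntropy G γ + ((Real.log q / K.card : ℝ) : EReal) ≤ coverEntropy G β := by
    refine coverEntropy_add_le hG fun F hF => ?_
    obtain ⟨S, hSF, hS, hcard⟩ := exists_separated_subset K hK1 hKinv F
    obtain ⟨m, hm1, -, hm⟩ := exists_minCard_dynJoin_eq_natCast (G := G) hβ.finite hβ.cover F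
    have hsum := sum_minCard_le_minCard_dynJoin (Y := Y)
      (fun x y h => hUsymm.symm x y h) (p := p)
      (fun y hy a b h1 h2 h3 => hpW y hy (hU3 _ _ _ _ h1 h2 h3).2)
      (fun x => refl_mem_uniformity hV) (fun x y h => hVsymm.symm x y h)
      (fun x a b y h1 h2 h3 => (hU3 _ _ _ _ h1 h2 h3).1)
      (fun x => (hγV₀ x).imp fun A hA => ⟨hA.1, fun y hy => hA.2 y (hV₁₀ (hVV hy))⟩)
      hβU hSF hS hspec n hn
    rw [hm, Nat.cast_le] at hsum
    have hsub : ∀ A, n F ≤ n (F \ (K * A)) * c ^ (K * A).card := by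
      intro A
      have hcov : F ⊆ K * A ∪ F \ (K * A) :=
        Finset.union_sdiff_self_eq_union.ge.trans' Finset.subset_union_right
      have h := (minCard_dynJoin_mono (α := γ) hcov).trans
        (minCard_dynJoin_union_le hγ.cover _ _)
      rw [hn, hn, ← hγ.finite.cast_ncard_eq] at h
      exact_mod_cast h
    have hmain : (n F : ℝ) * q ^ S.card ≤ m :=
      (mul_pow_le_sum hc1 hsub).trans (by exact_mod_cast hsum)
    have hnF : (0 : ℝ) < n F := by exact_mod_cast hn1 F
    have hlog : Real.log (n F) + S.card * Real.log q ≤ Real.log m := by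
      rw [← Real.log_pow, ← Real.log_mul hnF.ne' (by positivity)]
      exact Real.log_le_log (by positivity) hmain
    have hF0 : (0 : ℝ) < F.card := by exact_mod_cast hF.card_pos
    have hcard' : (F.card : ℝ) ≤ K.card * S.card := by exact_mod_cast hcard
    rw [logCardRatio_eq_coe (hn1 F) (hn F), logCardRatio_eq_coe hm1 hm, ← EReal.coe_add,
      EReal.coe_le_coe_iff, le_div_iff₀ hF0, add_mul, div_mul_cancel₀ _ hF0.ne']
    refine le_trans ?_ hlog
    have : Real.log q / K.card * F.card ≤ S.card * Real.log q := by
      rw [div_mul_eq_mul_div, div_le_iff₀ hK0]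
      nlinarith
    linarith
  have hYle : topEntropy G Y ≤ coverEntropy G γ := by
    refine iSup₂_le fun α hα => ?_
    obtain ⟨L, hL⟩ := exists_finset_dynJoin_refines hU₁c hexp hγU hα
    exact coverEntropy_le_of_dynJoin_refines hG hα.finite hα.cover hγ.finite hγ.cover hL
  refine hYle.trans_lt (lt_of_lt_of_le ?_ (hgap.trans
    (le_iSup₂ (f := fun α _ => coverEntropy G α) β hβ)))
  have htop := coverEntropy_lt_top (G := G) hγ.finite hγ.cover
  have hbot := EReal.bot_lt_zero.trans_le (coverEntropy_nonneg hG γ)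
  lift coverEntropy G γ to ℝ using ⟨htop.ne, hbot.ne'⟩ with e
  rw [← EReal.coe_add, EReal.coe_lt_coe_iff]
  exact lt_add_of_pos_right e (by positivity)
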